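/- Theorem 1 (Hypergeometric (ir)rationality criteria for $\gamma$). For a positive integer $N$ let $d_N=\mathrm{LCM}(1,2,\dots,N)$. For each integer $n>0$ define the positive integer $$S_n=\prod_{m=1}^{n}\ \prod_{k=0}^{\min(m-1,\,n-m)}\ \prod_{j=k+1}^{n-k}(n+m)^{\binom{n}{k}^2\frac{2d_{2n}}{j}}$$ (the exponents are integers because $j\mid d_{2n}$) and the real number $$I_n=\int_{n+1}^{\infty}\frac{(n!)^2\,\Gamma(t)}{(2n+1)\,\Gamma(2n+1+t)}\;{}_3F_2\!\left(\begin{matrix}n+1,\ n+1,\ 2n+1\\ 2n+2,\ 2n+1+t\end{matrix}\,\Big|\,1\right)dt,$$ where $${}_3F_2\!\left(\begin{matrix}a,\ b,\ c\\ d,\ e\end{matrix}\,\Big|\,z\right)=\sum_{k=0}^{\infty}\frac{(a)_k(b)_k(c)_k}{k!\,(d)_k(e)_k}z^k,\qquad (a)_0=1,\quad (a)_k=a(a+1)\cdots(a+k-1)\ \text{ for } k>0.$$ For every $n>0$ the series converges for all $t\ge n+1$ and the integral $I_n$ converges. Moreover, the following three statements are equivalent: (i) the fractional part of $\log S_n$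 is equal to $d_{2n}I_n$ for some $n>0$; (ii) the fractional part of $\log S_n$ is equal to $d_{2n}I_n$ for all sufficiently large $n$; (iii) Euler's constant $\gamma=\lim_{N\to\infty}\left(\sum_{k=1}^{N}\frac1k-\log N\right)$ is a rational number. -/

import Mathlib

/-- `d_n = LCM(1, 2, ..., n)`. -/
def lcmUpTo (n : ℕ) : ℕ := (Finset.Icc 1 n).lcm id

/-- The `k`-th term of the series defining `₃F₂(a, b, c; d, e | z)`; here `(a)_k` is the rising
factorial `a (a + 1) ⋯ (a + k - 1)`. -/
noncomputable def hyp3F2Term (a b c d e z : ℝ) (k : ℕ) : ℝ :=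
  ((ascPochhammer ℝ k).eval a * (ascPochhammer ℝ k).eval b * (ascPochhammer ℝ k).eval c) /
    ((k.factorial : ℝ) * (ascPochhammer ℝ k).eval d * (ascPochhammer ℝ k).eval e) * z ^ k

/-- The hypergeometric function `₃F₂(a, b, c; d, e | z)`. -/
noncomputable def hyp3F2 (a b c d e z : ℝ) : ℝ := ∑' k : ℕ, hyp3F2Term a b c d e z k

/-- The integer `S_n`. In every factor one has `1 ≤ j ≤ n`, so that `j` divides `d_{2n}` and the
division in the exponent is exact (`dvd_lcmUpTo`). -/
def sondowS (n : ℕ) : ℕ :=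
  ∏ m ∈ Finset.Icc 1 n, ∏ k ∈ Finset.Icc 0 (min (m - 1) (n - m)), ∏ j ∈ Finset.Icc (k + 1) (n - k),
    (n + m) ^ (n.choose k ^ 2 * (2 * lcmUpTo (2 * n) / j))

theorem dvd_lcmUpTo {j n : ℕ} (h1 : 1 ≤ j) (hn : j ≤ n) : j ∣ lcmUpTo n :=
  Finset.dvd_lcm (f := id) (Finset.mem_Icc.mpr ⟨h1, hn⟩)

theorem sondowS_pos (n : ℕ) : 0 < sondowS n := by
  unfold sondowS
  refine Finset.prod_pos fun m hm => Finset.prod_pos fun k _ => Finset.prod_pos fun j _ => ?_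
  have := (Finset.mem_Icc.mp hm).1
  exact pow_pos (by omega) _

/-- The integrand of `I_n`. -/
noncomputable def sondowIntegrand (n : ℕ) (t : ℝ) : ℝ :=
  ((n.factorial : ℝ) ^ 2 * Real.Gamma t) / ((2 * n + 1) * Real.Gamma (2 * n + 1 + t)) *
    hyp3F2 (n + 1) (n + 1) (2 * n + 1) (2 * n + 2) (2 * n + 1 + t) 1

/-- The hypergeometric integral `I_n`. -/
noncomputable def sondowI (n : ℕ) : ℝ :=
  ∫ t in Set.Ioi ((n : ℝ) + 1), sondowIntegrand n t

/-! Everything rests on the linear form `sondowI_eq`: I_n = C(2n,n) γ - A_n + L_n. Here d_{2n} A_n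
is an integer and d_{2n} L_n = log S_n (`log_sondowS`), so d_{2n} I_n and log S_n differ by d_{2n}
C(2n,n) γ up to an integer. If d_{2n} I_n is the fractional part of log S_n for a single n, then γ
is rational. Conversely, if γ has denominator at most 2n, that multiple of γ is an integer, and it
remains to know 0 < d_{2n} I_n < 1, which holds for large n.

The linear form comes from writing the integrand as the sum over ν of R(t + ν), where R(t) = (n! /
(t(t+1)⋯(t+n)))² is `betaSq`. Gauss's theorem expands R(t + ν) in a series over k; summing over ν
first telescopes and leaves the ₃F₂ series (`hasSum_integrandTerm`). Partial fractions of R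
(`betaSq_eq_sum`) then allow integration term by term: double poles give harmonic numbers, hence γ,
and simple poles give logarithms of factorials.

For smallness, I_n = O(n⁴ / 16^n). The elementary bound 4^N for the product of the primes up to N
only gives d_{2n} about 16^n, which just fails, so a sharper Chebyshev bound is proved
(`exists_theta_le`): θ(N) ≤ 1.3 N + O(1), where 2 · 1.3 < log 16. -/

open Filter Topology MeasureTheory

/-! ### Rising products and the Gamma function -/

/-- The rising product `t (t + 1) ⋯ (t + m - 1)`. -/
noncomputable def risingProd (m : ℕ) (t : ℝ) : ℝ := ∏ j ∈ Finset.range m, (t + j)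

theorem risingProd_zero (t : ℝ) : risingProd 0 t = 1 := by simp [risingProd]

theorem risingProd_succ (m : ℕ) (t : ℝ) :
    risingProd (m + 1) t = risingProd m t * (t + m) := by
  simp [risingProd, Finset.prod_range_succ]

theorem risingProd_succ' (m : ℕ) (t : ℝ) :
    risingProd (m + 1) t = t * risingProd m (t + 1) := by
  simp only [risingProd, Finset.prod_range_succ']
  rw [mul_comm]
  congr 1
  · simp
  · refine Finset.prod_congr rfl fun j _ => ?_
    push_cast; ring

theorem risingProd_pos (m : ℕ) {t : ℝ} (ht : 0 < t) : 0 < risingProd m t :=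
  Finset.prod_pos fun j _ => by positivity

theorem risingProd_add (m k : ℕ) (t : ℝ) :
    risingProd (m + k) t = risingProd m t * risingProd k (t + m) := by
  induction k with
  | zero => simp [risingProd_zero]
  | succ k ih =>
    rw [← add_assoc, risingProd_succ, ih, risingProd_succ]
    push_cast; ring

theorem risingProd_mono (m : ℕ) {s t : ℝ} (hs : 0 ≤ s) (h : s ≤ t) :
    risingProd m s ≤ risingProd m t :=
  Finset.prod_le_prod (fun j _ => by positivity) fun j _ => by linarith

theorem le_risingProd_succ (m : ℕ) {t : ℝ} (ht : 1 ≤ t) : t ≤ risingProd (m + 1) t := by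
  induction m with
  | zero => simp [risingProd]
  | succ m ih =>
    rw [risingProd_succ]
    have : (0 : ℝ) ≤ m := Nat.cast_nonneg m
    push_cast
    nlinarith

theorem risingProd_natCast_add_one (n k : ℕ) :
    risingProd k ((n : ℝ) + 1) = ((n + k).factorial : ℝ) / n.factorial := by
  induction k with
  | zero => rw [risingProd_zero, add_zero, div_self (by positivity)]
  | succ k ih =>
    rw [risingProd_succ, ih, ← add_assoc, Nat.factorial_succ]
    push_cast; ring

theorem factorial_le_risingProd (m : ℕ) {t : ℝ} (ht : 2 ≤ t) :
    ((m + 1).factorial : ℝ) ≤ risingProd m t := by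
  have h := risingProd_natCast_add_one 1 m
  simp only [Nat.factorial_one, Nat.cast_one, div_one] at h
  rw [add_comm, ← h]
  exact risingProd_mono m (by norm_num) (by linarith)

theorem ascPochhammer_eval_eq_risingProd (m : ℕ) (t : ℝ) :
    (ascPochhammer ℝ m).eval t = risingProd m t := by
  induction m with
  | zero => simp [risingProd_zero]
  | succ m ih => rw [ascPochhammer_succ_eval, ih, risingProd_succ]

theorem Gamma_add_natCast_eq_risingProd (m : ℕ) {t : ℝ} (ht : 0 < t) :
    Real.Gamma (t + m) = risingProd m t * Real.Gamma t := by
  induction m with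
  | zero => simp [risingProd_zero]
  | succ m ih =>
    have h : t + (m : ℝ) ≠ 0 := by positivity
    rw [risingProd_succ, Nat.cast_succ, ← add_assoc, Real.Gamma_add_one h, ih]
    ring

/-! ### Gauss's summation theorem -/

/-- The general term of Gauss's series `₂F₁(a + 1, b + 1; t + a + b + 2 | 1)`, normalised. -/
noncomputable def gaussTerm (a b : ℕ) (t : ℝ) (k : ℕ) : ℝ :=
  ((a + k).factorial * (b + k).factorial : ℝ) / (k.factorial * risingProd (a + b + 2 + k) t)

theorem gaussTerm_nonneg (a b : ℕ) {t : ℝ} (ht : 0 < t) (k : ℕ) : 0 ≤ gaussTerm a b t k := by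
  have := risingProd_pos (a + b + 2 + k) ht
  unfold gaussTerm; positivity

theorem sum_range_gaussTerm_zero (b : ℕ) {t : ℝ} (ht : 0 < t) (K : ℕ) :
    t * ∑ k ∈ Finset.range K, gaussTerm 0 b t k =
      b.factorial / risingProd (b + 1) t - (b + K).factorial / risingProd (b + 1 + K) t := by
  induction K with
  | zero => simp
  | succ K ih =>
    rw [Finset.sum_range_succ, mul_add, ih, gaussTerm]
    have h1 := (risingProd_pos (b + 1 + K) ht).ne'
    have h2 : t + ((b + 1 + K : ℕ) : ℝ) ≠ 0 := by positivity
    have h3 : (K.factorial : ℝ) ≠ 0 := by positivity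
    rw [show 0 + b + 2 + K = (b + 1 + K) + 1 by ring, show b + 1 + (K + 1) = (b + 1 + K) + 1 by ring,
      risingProd_succ (b + 1 + K), show b + (K + 1) = b + K + 1 by ring, Nat.factorial_succ,
      zero_add]
    field_simp
    push_cast
    ring

/-- A contiguous relation for partial sums. The boundary term vanishes in the limit
(`tendsto_mul_gaussTerm`), so Gauss's theorem follows by induction on `a` from the telescoping case
`a = 0`. -/
theorem sum_range_gaussTerm_succ (a b : ℕ) {t : ℝ} (ht : 0 < t) (K : ℕ) :
    (t + a + 1) * ∑ k ∈ Finset.range K, gaussTerm (a + 1) b t k =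
      (a + 1) * ∑ k ∈ Finset.range K, gaussTerm a b t k - K * gaussTerm a b t K := by
  induction K with
  | zero => simp
  | succ K ih =>
    rw [Finset.sum_range_succ, mul_add, ih, Finset.sum_range_succ, mul_add]
    simp only [gaussTerm]
    have h1 := (risingProd_pos (a + b + 2 + K) ht).ne'
    have h2 : t + ((a + b + 2 + K : ℕ) : ℝ) ≠ 0 := by positivity
    have h3 : (K.factorial : ℝ) ≠ 0 := by positivity
    have h4 : (K : ℝ) + 1 ≠ 0 := by positivity
    rw [show a + 1 + b + 2 + K = (a + b + 2 + K) + 1 by ring,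
      show a + b + 2 + (K + 1) = (a + b + 2 + K) + 1 by ring,
      risingProd_succ, show a + (K + 1) = a + K + 1 by ring, show a + 1 + K = a + K + 1 by ring,
      show b + (K + 1) = b + K + 1 by ring, Nat.factorial_succ, Nat.factorial_succ,
      Nat.factorial_succ]
    push_cast at h2 ⊢
    field_simp
    ring

theorem tendsto_mul_gaussTerm {a b : ℕ} (hab : a ≤ b) {t : ℝ} (ht : 2 ≤ t) :
    Tendsto (fun K : ℕ => K * gaussTerm a b t K) atTop (𝓝 0) := by
  refine squeeze_zero (g := fun K : ℕ => 1 / ((K : ℝ) + 1))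
    (fun K => mul_nonneg (Nat.cast_nonneg K) (gaussTerm_nonneg a b (by linarith) K)) (fun K => ?_)
    tendsto_one_div_add_atTop_nhds_zero_nat
  -- For `t ≥ 2` the denominator exceeds `(b + K)!` by `a + 3` factors of size at least `b + K + 1`.
  -- The factor `(a + K)! / K!` uses up `a` of them, so the term is `O(K⁻³)`, more than enough.
  have h1 := factorial_le_risingProd (a + b + 2 + K) ht
  have h2 : ((a + K).factorial : ℝ) ≤ K.factorial * ((b : ℝ) + K + 1) ^ a := by
    have h : (a + K).factorial ≤ K.factorial * (K + a) ^ a := by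
      rw [add_comm a K, ← Nat.factorial_mul_ascFactorial]
      gcongr
      exact Nat.ascFactorial_le_pow_add _ _
    calc ((a + K).factorial : ℝ) ≤ K.factorial * ((K : ℝ) + a) ^ a := by exact_mod_cast h
      _ ≤ _ := by
        have : (a : ℝ) ≤ b := by exact_mod_cast hab
        exact mul_le_mul_of_nonneg_left (pow_le_pow_left₀ (by positivity) (by linarith) a)
          (by positivity)
  have h3 : ((b + K).factorial : ℝ) * ((b : ℝ) + K + 1) ^ (a + 3)
      ≤ ((a + b + 2 + K + 1).factorial : ℝ) := by
    have := Nat.factorial_mul_pow_le_factorial (m := b + K) (n := a + 3)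
    rw [show a + b + 2 + K + 1 = b + K + (a + 3) by ring]
    exact_mod_cast this
  have h5 : 0 < (b : ℝ) + K + 1 := by positivity
  have h6 := risingProd_pos (a + b + 2 + K) (show 0 < t by linarith)
  have hK : (K : ℝ) ≤ (b : ℝ) + K + 1 := by
    have : (0 : ℝ) ≤ b := Nat.cast_nonneg b
    linarith
  have hK' : (K : ℝ) + 1 ≤ (b : ℝ) + K + 1 := by
    have : (0 : ℝ) ≤ b := Nat.cast_nonneg b
    linarith
  rw [gaussTerm, ← mul_div_assoc, div_le_div_iff₀ (by positivity) (by positivity), one_mul]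
  calc (K : ℝ) * ((a + K).factorial * (b + K).factorial) * (K + 1)
      ≤ ((b : ℝ) + K + 1) * ((K.factorial * ((b : ℝ) + K + 1) ^ a) * (b + K).factorial) *
        ((b : ℝ) + K + 1) := by gcongr
    _ = K.factorial * ((b + K).factorial * ((b : ℝ) + K + 1) ^ (a + 2)) := by ring
    _ ≤ K.factorial * ((b + K).factorial * ((b : ℝ) + K + 1) ^ (a + 3)) := by
        gcongr
        · linarith [(Nat.cast_nonneg K : (0 : ℝ) ≤ K)]
        · norm_num
    _ ≤ _ := by gcongr; exact h3.trans h1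

/-- Gauss's summation theorem for `₂F₁(a + 1, b + 1; t + a + b + 2 | 1)`. -/
theorem hasSum_gaussTerm {a b : ℕ} (hab : a ≤ b) {t : ℝ} (ht : 2 ≤ t) :
    HasSum (gaussTerm a b t)
      (a.factorial / risingProd (a + 1) t * (b.factorial / risingProd (b + 1) t)) := by
  have ht0 : 0 < t := by linarith
  rw [hasSum_iff_tendsto_nat_of_nonneg (gaussTerm_nonneg a b ht0)]
  induction a with
  | zero =>
    have hlim : Tendsto (fun K : ℕ => ((b + K).factorial : ℝ) / risingProd (b + 1 + K) t) atTop
        (𝓝 0) := by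
      refine squeeze_zero (g := fun K : ℕ => 1 / ((K : ℝ) + 1)) (fun K => ?_) (fun K => ?_)
        tendsto_one_div_add_atTop_nhds_zero_nat
      · have := risingProd_pos (b + 1 + K) ht0
        positivity
      · have h := factorial_le_risingProd (b + 1 + K) ht
        rw [div_le_div_iff₀ (risingProd_pos _ ht0) (by positivity), one_mul]
        refine le_trans ?_ h
        rw [show b + 1 + K + 1 = (b + K + 1) + 1 by ring, Nat.factorial_succ, Nat.factorial_succ]
        have h0 : (K + 1) * (b + K).factorial ≤ (b + K + 1 + 1) * ((b + K + 1) * (b + K).factorial) := by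
          have : (K + 1) * 1 ≤ (b + K + 1 + 1) * (b + K + 1) := by gcongr <;> omega
          nlinarith [(b + K).factorial_pos]
        rw [mul_comm]
        exact_mod_cast h0
    have h := (hlim.const_sub (b.factorial / risingProd (b + 1) t)).const_mul t⁻¹
    convert h using 1
    · funext K
      rw [← sum_range_gaussTerm_zero b ht0, inv_mul_cancel_left₀ ht0.ne']
    · rw [sub_zero, Nat.factorial_zero, risingProd_succ, risingProd_zero]
      simp
  | succ a ih =>
    have h := (((ih (by omega)).const_mul ((a : ℝ) + 1)).sub
      (tendsto_mul_gaussTerm (show a ≤ b by omega) ht)).const_mul (t + a + 1)⁻¹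
    have hne : t + a + 1 ≠ 0 := by positivity
    have hp := (risingProd_pos (a + 1) ht0).ne'
    convert h using 1
    · funext K
      rw [← sum_range_gaussTerm_succ a b ht0, inv_mul_cancel_left₀ hne]
    · rw [risingProd_succ _ t, Nat.factorial_succ]
      push_cast
      congr 1
      field_simp
      ring

/-! ### The ₃F₂ integrand as a sum of shifted squares -/

/-- The square of `n! / (t (t + 1) ⋯ (t + n))`. -/
noncomputable def betaSq (n : ℕ) (t : ℝ) : ℝ := (n.factorial / risingProd (n + 1) t) ^ 2

theorem betaSq_pos (n : ℕ) {t : ℝ} (ht : 0 < t) : 0 < betaSq n t := by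
  have := risingProd_pos (n + 1) ht
  unfold betaSq; positivity

theorem hasSum_gaussTerm_betaSq (n : ℕ) {t : ℝ} (ht : 2 ≤ t) :
    HasSum (gaussTerm n n t) (betaSq n t) := by
  rw [betaSq, sq]
  exact hasSum_gaussTerm le_rfl ht

theorem inv_risingProd_sub (m : ℕ) {t : ℝ} (ht : 0 < t) :
    (risingProd m t)⁻¹ - (risingProd m (t + 1))⁻¹ = m * (risingProd (m + 1) t)⁻¹ := by
  have h1 := (risingProd_pos m ht).ne'
  have h2 := (risingProd_pos m (show 0 < t + 1 by linarith)).ne'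
  have h3 : t + m ≠ 0 := by positivity
  have h : t * risingProd m (t + 1) = risingProd m t * (t + m) := by
    rw [← risingProd_succ', risingProd_succ]
  have h4 : (risingProd m (t + 1))⁻¹ = t * (risingProd m t * (t + m))⁻¹ := by
    rw [← h]; field_simp
  rw [h4, risingProd_succ]
  field_simp
  ring

/-- Telescopes by `inv_risingProd_sub`. -/
theorem hasSum_inv_risingProd (m : ℕ) {t : ℝ} (ht : 1 ≤ t) :
    HasSum (fun ν : ℕ => ((m : ℝ) + 1) * (risingProd (m + 2) (t + ν))⁻¹)
      (risingProd (m + 1) t)⁻¹ := by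
  have ht0 : 0 < t := by linarith
  have hpos (ν : ℕ) : 0 < t + ν := by positivity
  rw [hasSum_iff_tendsto_nat_of_nonneg (fun ν => by have := risingProd_pos (m + 2) (hpos ν); positivity)]
  have hsum (M : ℕ) : ∑ ν ∈ Finset.range M, ((m : ℝ) + 1) * (risingProd (m + 2) (t + ν))⁻¹ =
      (risingProd (m + 1) t)⁻¹ - (risingProd (m + 1) (t + M))⁻¹ := by
    induction M with
    | zero => simp
    | succ M ih =>
      have := inv_risingProd_sub (m + 1) (hpos M)
      rw [Finset.sum_range_succ, ih]
      push_cast at this ⊢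
      rw [← this, add_assoc t]
      ring
  have hlim : Tendsto (fun M : ℕ => (risingProd (m + 1) (t + M))⁻¹) atTop (𝓝 0) :=
    tendsto_inv_atTop_zero.comp <| tendsto_atTop_mono
      (fun M => (show (M : ℝ) ≤ t + M by linarith).trans
        (le_risingProd_succ m (by linarith [(Nat.cast_nonneg M : (0 : ℝ) ≤ M)])))
      tendsto_natCast_atTop_atTop
  simp only [hsum]
  simpa using hlim.const_sub _

/-- The general term of the `₃F₂`-series of `sondowIntegrand`, including its prefactor. -/
noncomputable def integrandTerm (n : ℕ) (t : ℝ) (k : ℕ) : ℝ :=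
  ((n + k).factorial : ℝ) ^ 2 / (k.factorial * (2 * n + 1 + k) * risingProd (2 * n + 1 + k) t)

theorem hasSum_gaussTerm_shift (n k : ℕ) {t : ℝ} (ht : 1 ≤ t) :
    HasSum (fun ν : ℕ => gaussTerm n n (t + ν) k) (integrandTerm n t k) := by
  have h := (hasSum_inv_risingProd (2 * n + k) ht).mul_left
    (((n + k).factorial : ℝ) ^ 2 / (k.factorial * (2 * n + 1 + k)))
  convert! h using 1
  · funext ν
    have : (2 * n + 1 + k : ℝ) ≠ 0 := by positivity
    have hp := (risingProd_pos (n + n + 2 + k) (show 0 < t + ν by positivity)).ne'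
    rw [gaussTerm, show 2 * n + k + 2 = n + n + 2 + k by ring]
    push_cast
    field_simp
    ring
  · rw [integrandTerm, show 2 * n + k + 1 = 2 * n + 1 + k by ring]
    field_simp

theorem summable_betaSq_shift (n : ℕ) {t : ℝ} (ht : 1 ≤ t) :
    Summable fun ν : ℕ => betaSq n (t + ν) := by
  have h := ((summable_nat_add_iff 1).2
    (Real.summable_one_div_nat_pow.2 (show 1 < 2 by norm_num))).mul_left ((n.factorial : ℝ) ^ 2)
  refine Summable.of_nonneg_of_le (fun ν => (betaSq_pos n (by positivity)).le) (fun ν => ?_) h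
  have h1 : ((ν + 1 : ℕ) : ℝ) ≤ risingProd (n + 1) (t + ν) := by
    push_cast
    exact (by linarith : (ν : ℝ) + 1 ≤ t + ν).trans
      (le_risingProd_succ n (by linarith [(Nat.cast_nonneg ν : (0 : ℝ) ≤ ν)]))
  rw [betaSq, div_pow, mul_one_div]
  gcongr

/-- Tonelli's theorem for a nonnegative double series. -/
theorem hasSum_columns_of_rows {α β : Type*} {f : α → β → ℝ} {g : α → ℝ} {h : β → ℝ}
    (hf : ∀ a b, 0 ≤ f a b) (hrow : ∀ a, HasSum (f a) (g a))
    (hcol : ∀ b, HasSum (fun a => f a b) (h b)) (hg : Summable g) : HasSum h (∑' a, g a) := by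
  have hS : Summable (fun p : α × β => f p.1 p.2) := by
    refine (summable_prod_of_nonneg fun p => hf p.1 p.2).2 ⟨fun a => (hrow a).summable, ?_⟩
    simpa only [(hrow _).tsum_eq] using hg
  have h1 : HasSum g (∑' p : α × β, f p.1 p.2) := hS.hasSum.prod_fiberwise hrow
  have h2 := ((Equiv.prodComm β α).hasSum_iff.2 hS.hasSum).prod_fiberwise hcol
  rwa [h1.tsum_eq]

theorem hasSum_integrandTerm (n : ℕ) {t : ℝ} (ht : 2 ≤ t) :
    HasSum (integrandTerm n t) (∑' ν : ℕ, betaSq n (t + ν)) := by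
  have hge (ν : ℕ) : 2 ≤ t + ν := by linarith [(Nat.cast_nonneg ν : (0 : ℝ) ≤ ν)]
  exact hasSum_columns_of_rows
    (fun ν k => gaussTerm_nonneg n n (zero_lt_two.trans_le (hge ν)) k)
    (fun ν => hasSum_gaussTerm_betaSq n (hge ν))
    (fun k => hasSum_gaussTerm_shift n k (one_le_two.trans ht))
    (summable_betaSq_shift n (one_le_two.trans ht))

/-- The Gamma quotient supplies the first `2n + 1` factors of the rising product, and `(2n+1)_k /
(2n+2)_k` collapses to `(2n+1) / (2n+1+k)`. -/
theorem prefactor_mul_hyp3F2Term (n : ℕ) {t : ℝ} (ht : 0 < t) (k : ℕ) :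
    ((n.factorial : ℝ) ^ 2 * Real.Gamma t) / ((2 * n + 1) * Real.Gamma (2 * n + 1 + t)) *
      hyp3F2Term (n + 1) (n + 1) (2 * n + 1) (2 * n + 2) (2 * n + 1 + t) 1 k =
      integrandTerm n t k := by
  have hG := Gamma_add_natCast_eq_risingProd (2 * n + 1) ht
  have h2 := risingProd_natCast_add_one (2 * n) k
  have h3 := risingProd_natCast_add_one (2 * n + 1) k
  have h4 := risingProd_add (2 * n + 1) k t
  have hΓ := (Real.Gamma_pos_of_pos ht).ne'
  have hp1 := (risingProd_pos (2 * n + 1) ht).ne'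
  have hp2 := (risingProd_pos k (show 0 < t + ((2 * n + 1 : ℕ) : ℝ) by positivity)).ne'
  have hf : ((2 * n + 1 + k).factorial : ℝ) = (2 * n + 1 + k) * (2 * n + k).factorial := by
    rw [show 2 * n + 1 + k = (2 * n + k) + 1 by ring, Nat.factorial_succ]
    push_cast; ring
  have hf' : ((2 * n + 1).factorial : ℝ) = (2 * n + 1) * (2 * n).factorial := by
    rw [Nat.factorial_succ]; push_cast; ring
  rw [hf, hf'] at h3
  push_cast at hG h2 h3 h4 hp2
  rw [hyp3F2Term, integrandTerm, h4]
  simp only [ascPochhammer_eval_eq_risingProd]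
  rw [show (2 * n + 1 + t : ℝ) = t + (2 * n + 1) by ring, hG,
    show (2 * n + 2 : ℝ) = 2 * n + 1 + 1 by ring, h2, h3, risingProd_natCast_add_one, one_pow]
  field_simp

theorem hasSum_prefactor_mul_hyp3F2Term (n : ℕ) {t : ℝ} (ht : 2 ≤ t) :
    HasSum (fun k => ((n.factorial : ℝ) ^ 2 * Real.Gamma t) /
      ((2 * n + 1) * Real.Gamma (2 * n + 1 + t)) *
        hyp3F2Term (n + 1) (n + 1) (2 * n + 1) (2 * n + 2) (2 * n + 1 + t) 1 k)
      (∑' ν : ℕ, betaSq n (t + ν)) := by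
  simp only [prefactor_mul_hyp3F2Term n (show 0 < t by linarith)]
  exact hasSum_integrandTerm n ht

theorem summable_hyp3F2Term (n : ℕ) {t : ℝ} (ht : 2 ≤ t) :
    Summable (hyp3F2Term (n + 1) (n + 1) (2 * n + 1) (2 * n + 2) (2 * n + 1 + t) 1) := by
  have h1 := Real.Gamma_pos_of_pos (show 0 < t by linarith)
  have h2 := Real.Gamma_pos_of_pos (show 0 < 2 * n + 1 + t by positivity)
  exact (summable_mul_left_iff (by positivity)).1 (hasSum_prefactor_mul_hyp3F2Term n ht).summable

theorem sondowIntegrand_eq_tsum (n : ℕ) {t : ℝ} (ht : 2 ≤ t) :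
    sondowIntegrand n t = ∑' ν : ℕ, betaSq n (t + ν) := by
  rw [sondowIntegrand, hyp3F2, ← tsum_mul_left]
  exact (hasSum_prefactor_mul_hyp3F2Term n ht).tsum_eq

/-! ### Alternating binomial sums and partial fractions -/

/-- The coefficient `(-1)^k * n.choose k`. -/
noncomputable def altChoose (n k : ℕ) : ℝ := (-1) ^ k * (n.choose k : ℝ)

theorem altChoose_sq (n k : ℕ) : altChoose n k ^ 2 = (n.choose k : ℝ) ^ 2 := by
  rw [altChoose, mul_pow, ← pow_mul, mul_comm k, pow_mul]; simp

theorem altChoose_succ_succ (n k : ℕ) :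
    altChoose (n + 1) (k + 1) = altChoose n (k + 1) - altChoose n k := by
  simp only [altChoose, Nat.choose_succ_succ, pow_succ]
  push_cast; ring

theorem altChoose_succ_mul (n k : ℕ) (hk : k ≤ n + 1) :
    ((n : ℝ) + 1 - k) * altChoose (n + 1) k = (n + 1) * altChoose n k := by
  have h' := Nat.choose_mul_succ_eq n k
  have h2 : ((n.choose k * (n + 1) : ℕ) : ℝ) = (((n + 1).choose k * (n + 1 - k) : ℕ) : ℝ) := by
    rw [h']
  rw [Nat.cast_mul, Nat.cast_mul, Nat.cast_sub hk] at h2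
  push_cast at h2
  simp only [altChoose]
  linear_combination (-(-1) ^ k) * h2

theorem sum_altChoose {n : ℕ} (hn : n ≠ 0) : ∑ k ∈ Finset.range (n + 1), altChoose n k = 0 := by
  have h := Int.alternating_sum_range_choose_of_ne hn
  simp only [altChoose]
  exact_mod_cast h

theorem factorial_div_risingProd_eq_sum (n : ℕ) {t : ℝ} (ht : 0 < t) :
    n.factorial / risingProd (n + 1) t =
      ∑ k ∈ Finset.range (n + 1), altChoose n k / (t + k) := by
  induction n generalizing t with
  | zero => simp [risingProd, altChoose]
  | succ n ih =>
    have h := inv_risingProd_sub (n + 1) ht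
    have h1 : ((n + 1).factorial : ℝ) / risingProd (n + 1 + 1) t =
        n.factorial / risingProd (n + 1) t - n.factorial / risingProd (n + 1) (t + 1) := by
      rw [div_eq_mul_inv, div_eq_mul_inv, div_eq_mul_inv, ← mul_sub, h, Nat.factorial_succ]
      push_cast; ring
    rw [h1, ih ht, ih (by linarith), Finset.sum_range_succ' _ (n + 1)]
    simp only [altChoose_succ_succ, sub_div, Finset.sum_sub_distrib]
    have h2 : ∑ k ∈ Finset.range (n + 1), altChoose n (k + 1) / (t + ((k + 1 : ℕ) : ℝ)) +
        altChoose n 0 / (t + ((0 : ℕ) : ℝ)) = ∑ k ∈ Finset.range (n + 1), altChoose n k / (t + k) := by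
      rw [← Finset.sum_range_succ' (fun k => altChoose n k / (t + (k : ℝ)))]
      rw [Finset.sum_range_succ, add_eq_left]
      simp [altChoose]
    have h3 : altChoose (n + 1) 0 = altChoose n 0 := by simp [altChoose]
    rw [← h2, h3]
    push_cast
    simp only [add_assoc, add_comm (1 : ℝ)]
    ring

/-- The sum `∑_{l ≠ k} (-1)^l C(n, l) / (l - k)`; the term `l = k` vanishes by convention. -/
noncomputable def altHarmonicSum (n k : ℕ) : ℝ :=
  ∑ l ∈ Finset.range (n + 1), altChoose n l / ((l : ℝ) - k)

theorem altHarmonicSum_succ {n k : ℕ} (hk : k ≤ n) :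
    ((n : ℝ) + 1 - k) * altHarmonicSum (n + 1) k =
      (n + 1) * altHarmonicSum n k - altChoose (n + 1) k := by
  have hterm (l : ℕ) (hl : l ∈ Finset.range (n + 2)) :
      ((n : ℝ) + 1 - k) * (altChoose (n + 1) l / ((l : ℝ) - k)) =
        (n + 1) * (altChoose n l / ((l : ℝ) - k)) +
          (altChoose (n + 1) l - if k = l then altChoose (n + 1) l else 0) := by
    have h := altChoose_succ_mul n l (by have := Finset.mem_range.1 hl; omega)
    split_ifs with hkl
    · simp [hkl]
    · have hne : (l : ℝ) - k ≠ 0 := sub_ne_zero.2 (by exact_mod_cast Ne.symm hkl)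
      field_simp
      linear_combination h
  rw [altHarmonicSum, altHarmonicSum, Finset.mul_sum, Finset.sum_congr rfl hterm,
    Finset.sum_add_distrib, Finset.sum_sub_distrib, sum_altChoose n.succ_ne_zero,
    Finset.sum_ite_eq, if_pos (Finset.mem_range.2 (by omega)), ← Finset.mul_sum,
    Finset.sum_range_succ _ (n + 1)]
  have : altChoose n (n + 1) = 0 := by simp [altChoose]
  rw [this]
  ring

theorem altHarmonicSum_reflect {n k : ℕ} (hk : k ≤ n) :
    altHarmonicSum n (n - k) = -(-1) ^ n * altHarmonicSum n k := by
  rw [altHarmonicSum, ← Finset.sum_range_reflect, altHarmonicSum, Finset.mul_sum]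
  refine Finset.sum_congr rfl fun l hl => ?_
  have hl' : l ≤ n := by have := Finset.mem_range.1 hl; omega
  rw [show n + 1 - 1 - l = n - l by omega, altChoose, altChoose, Nat.choose_symm hl',
    Nat.cast_sub hl', Nat.cast_sub hk]
  have hs : (-1 : ℝ) ^ (n - l) = (-1) ^ n * (-1) ^ l := by
    obtain ⟨m, rfl⟩ := Nat.exists_eq_add_of_le hl'
    rw [Nat.add_sub_cancel_left, pow_add, mul_right_comm, ← mul_pow]; simp
  rw [hs, show (n : ℝ) - l - (n - k) = -(l - k) by ring, div_neg]
  ring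

theorem altHarmonicSum_eq_of_base {k : ℕ}
    (hbase : altHarmonicSum k k = altChoose k k * (harmonic k : ℝ)) {n : ℕ} (hk : k ≤ n) :
    altHarmonicSum n k = altChoose n k * ((harmonic k : ℝ) - harmonic (n - k)) := by
  induction n, hk using Nat.le_induction with
  | base => simpa using hbase
  | succ n hk ih =>
    have hpos : (n : ℝ) + 1 - k ≠ 0 := by
      have : (k : ℝ) ≤ n := by exact_mod_cast hk
      linarith
    have h := altHarmonicSum_succ hk
    have h2 := altChoose_succ_mul n k (by omega)
    rw [ih] at h
    refine mul_left_cancel₀ hpos ?_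
    rw [h, show n + 1 - k = (n - k) + 1 by omega, harmonic_succ]
    push_cast [Nat.cast_sub hk]
    rw [show (n : ℝ) - k + 1 = n + 1 - k by ring]
    field_simp
    linear_combination (-((harmonic k : ℝ) - harmonic (n - k))) * h2

/-- The recurrence in `n` settles `k = 0` outright; reflection turns that into the base case `n = k`
for general `k`, from which the recurrence starts again. -/
theorem altHarmonicSum_eq {n k : ℕ} (hk : k ≤ n) :
    altHarmonicSum n k = altChoose n k * ((harmonic k : ℝ) - harmonic (n - k)) := by
  refine altHarmonicSum_eq_of_base ?_ hk
  have h0 := altHarmonicSum_eq_of_base (k := 0) (by simp [altHarmonicSum]) k.zero_le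
  have h1 := altHarmonicSum_reflect (n := k) k.zero_le
  rw [Nat.sub_zero] at h1
  rw [h1, h0]
  simp [altChoose]

/-- The coefficient of `1 / (t + k)` in the partial fraction expansion of `betaSq n t`. -/
noncomputable def logCoeff (n k : ℕ) : ℝ :=
  2 * (n.choose k : ℝ) ^ 2 * ((harmonic k : ℝ) - harmonic (n - k))

theorem logCoeff_eq {n k : ℕ} (hk : k ≤ n) :
    logCoeff n k = 2 * altChoose n k * altHarmonicSum n k := by
  rw [altHarmonicSum_eq hk, logCoeff, ← altChoose_sq]; ring

theorem logCoeff_reflect {n k : ℕ} (hk : k ≤ n) : logCoeff n (n - k) = -logCoeff n k := by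
  rw [logCoeff, logCoeff, Nat.choose_symm hk, Nat.sub_sub_self hk]; ring

theorem betaSq_eq_sum (n : ℕ) {t : ℝ} (ht : 0 < t) :
    betaSq n t = ∑ k ∈ Finset.range (n + 1),
      ((n.choose k : ℝ) ^ 2 / (t + k) ^ 2 + logCoeff n k / (t + k)) := by
  -- Partial fractions of `1 / ((t+k)(t+l))`; on the diagonal the last two terms vanish because
  -- division by zero gives zero.
  have hpair (k l : ℕ) : altChoose n k / (t + k) * (altChoose n l / (t + l)) =
      (if k = l then altChoose n l ^ 2 / (t + l) ^ 2 else 0) +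
        (altChoose n k / (t + k) * (altChoose n l / ((l : ℝ) - k)) +
          altChoose n l / (t + l) * (altChoose n k / ((k : ℝ) - l))) := by
    have h1 : t + k ≠ 0 := by positivity
    have h2 : t + l ≠ 0 := by positivity
    split_ifs with h
    · subst h; simp; field_simp
    · have hne : (l : ℝ) - k ≠ 0 := sub_ne_zero.2 (by exact_mod_cast Ne.symm h)
      rw [← neg_sub (l : ℝ) k]
      field_simp
      ring
  rw [betaSq, factorial_div_risingProd_eq_sum n ht, sq, Finset.sum_mul_sum]
  simp only [hpair, Finset.sum_add_distrib]
  rw [Finset.sum_comm (f := fun k l => altChoose n l / (t + l) * (altChoose n k / ((k : ℝ) - l))),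
    ← two_mul, Finset.mul_sum]
  congr 1
  · refine Finset.sum_congr rfl fun k hk => ?_
    rw [Finset.sum_ite_eq, if_pos hk, altChoose_sq]
  · refine Finset.sum_congr rfl fun k hk => ?_
    rw [logCoeff_eq (by have := Finset.mem_range.1 hk; omega), altHarmonicSum, ← Finset.mul_sum]
    ring

/-- The reflection `k ↦ n - k` changes the sign. This cancels the `log t` growth of the primitive at
infinity. -/
theorem sum_logCoeff (n : ℕ) : ∑ k ∈ Finset.range (n + 1), logCoeff n k = 0 := by
  have h : ∑ k ∈ Finset.range (n + 1), logCoeff n k =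
      -∑ k ∈ Finset.range (n + 1), logCoeff n k := by
    conv_lhs => rw [← Finset.sum_range_reflect]
    rw [← Finset.sum_neg_distrib]
    refine Finset.sum_congr rfl fun k hk => ?_
    rw [Nat.add_sub_cancel, logCoeff_reflect (by have := Finset.mem_range.1 hk; omega)]
  linarith

theorem sum_choose_sq (n : ℕ) :
    ∑ k ∈ Finset.range (n + 1), (n.choose k : ℝ) ^ 2 = n.centralBinom := by
  exact_mod_cast Nat.sum_range_choose_sq n

/-- Symmetrising in `k` and `l` turns each off-diagonal quotient into `-1`, and the alternating sum
vanishes. The value matches the sum of squared binomials, so the `log N` terms cancel in the linear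
form. -/
theorem sum_mul_logCoeff {n : ℕ} (hn : n ≠ 0) :
    ∑ k ∈ Finset.range (n + 1), (k : ℝ) * logCoeff n k = n.centralBinom := by
  have h1 : ∑ k ∈ Finset.range (n + 1), (k : ℝ) * logCoeff n k =
      2 * ∑ k ∈ Finset.range (n + 1), ∑ l ∈ Finset.range (n + 1),
        (k : ℝ) * (altChoose n k * (altChoose n l / ((l : ℝ) - k))) := by
    rw [Finset.mul_sum]
    refine Finset.sum_congr rfl fun k hk => ?_
    rw [logCoeff_eq (by have := Finset.mem_range.1 hk; omega), altHarmonicSum, ← Finset.mul_sum,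
      ← Finset.mul_sum]
    ring
  have hpair (k l : ℕ) : (k : ℝ) * (altChoose n k * (altChoose n l / ((l : ℝ) - k))) +
      (l : ℝ) * (altChoose n l * (altChoose n k / ((k : ℝ) - l))) =
        (if k = l then altChoose n l ^ 2 else 0) - altChoose n k * altChoose n l := by
    split_ifs with h
    · subst h; simp; ring
    · have hne : (l : ℝ) - k ≠ 0 := sub_ne_zero.2 (by exact_mod_cast Ne.symm h)
      rw [← neg_sub (l : ℝ) k]
      field_simp
      ring
  rw [h1, two_mul]
  nth_rewrite 2 [Finset.sum_comm]
  simp only [← Finset.sum_add_distrib, hpair, Finset.sum_sub_distrib]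
  rw [← Finset.sum_mul_sum, sum_altChoose hn, zero_mul, sub_zero, ← sum_choose_sq]
  refine Finset.sum_congr rfl fun k hk => ?_
  rw [Finset.sum_ite_eq, if_pos hk, altChoose_sq]

/-! ### Termwise integration -/

/-- A primitive of `betaSq n` on the positive half-line, vanishing at infinity. -/
noncomputable def betaSqPrimitive (n : ℕ) (t : ℝ) : ℝ :=
  ∑ k ∈ Finset.range (n + 1),
    (-((n.choose k : ℝ) ^ 2 / (t + k)) + logCoeff n k * Real.log (t + k))

theorem hasDerivAt_betaSqPrimitive (n : ℕ) {t : ℝ} (ht : 0 < t) :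
    HasDerivAt (betaSqPrimitive n) (betaSq n t) t := by
  rw [betaSq_eq_sum n ht]
  refine HasDerivAt.fun_sum fun k _ => ?_
  have hk : t + k ≠ 0 := by positivity
  have h1 : HasDerivAt (fun t : ℝ => t + k) 1 t := (hasDerivAt_id t).add_const _
  have h2 := ((h1.inv hk).const_mul ((n.choose k : ℝ) ^ 2)).neg
  have h3 := (h1.log hk).const_mul (logCoeff n k)
  convert! h2.add h3 using 1
  field_simp

theorem tendsto_log_add_natCast_sub_log (k : ℕ) :
    Tendsto (fun t : ℝ => Real.log (t + k) - Real.log t) atTop (𝓝 0) := by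
  have h1 : Tendsto (fun t : ℝ => 1 + (k : ℝ) / t) atTop (𝓝 1) := by
    simpa using (tendsto_id.const_div_atTop (k : ℝ)).const_add 1
  have h2 := (Real.continuousAt_log one_ne_zero).tendsto.comp h1
  rw [Real.log_one] at h2
  refine h2.congr' ?_
  filter_upwards [eventually_gt_atTop 0] with t ht
  have : t + k ≠ 0 := by positivity
  rw [Function.comp_apply, ← Real.log_div this ht.ne', add_div, div_self ht.ne']

theorem tendsto_betaSqPrimitive (n : ℕ) : Tendsto (betaSqPrimitive n) atTop (𝓝 0) := by
  have h (k : ℕ) : Tendsto (fun t : ℝ => -((n.choose k : ℝ) ^ 2 / (t + k)) +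
      logCoeff n k * (Real.log (t + k) - Real.log t)) atTop (𝓝 0) := by
    have h1 : Tendsto (fun t : ℝ => t + k) atTop atTop := tendsto_atTop_add_const_right _ _ tendsto_id
    simpa using (h1.const_div_atTop ((n.choose k : ℝ) ^ 2)).neg.add
      ((tendsto_log_add_natCast_sub_log k).const_mul (logCoeff n k))
  have hs := tendsto_finsetSum (Finset.range (n + 1)) fun k _ => h k
  rw [Finset.sum_const_zero] at hs
  refine hs.congr fun t => ?_
  simp only [betaSqPrimitive, mul_sub, Finset.sum_add_distrib, Finset.sum_sub_distrib]
  rw [← Finset.sum_mul, sum_logCoeff, zero_mul, sub_zero]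

theorem hasDerivAt_betaSqPrimitive_shift (n ν : ℕ) {t : ℝ} (ht : 0 < t) :
    HasDerivAt (fun t => betaSqPrimitive n (t + ν)) (betaSq n (t + ν)) t := by
  simpa using (hasDerivAt_betaSqPrimitive n (show 0 < t + ν by positivity)).comp_add_const t ν

theorem tendsto_betaSqPrimitive_shift (n ν : ℕ) :
    Tendsto (fun t : ℝ => betaSqPrimitive n (t + ν)) atTop (𝓝 0) :=
  (tendsto_betaSqPrimitive n).comp (tendsto_atTop_add_const_right _ _ tendsto_id)

theorem integrableOn_betaSq_shift (n ν : ℕ) {a : ℝ} (ha : 0 < a) :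
    IntegrableOn (fun t => betaSq n (t + ν)) (Set.Ioi a) :=
  integrableOn_Ioi_deriv_of_nonneg'
    (fun _ ht => hasDerivAt_betaSqPrimitive_shift n ν (ha.trans_le ht))
    (fun t ht => (betaSq_pos n (by have := ha.trans ht; positivity)).le)
    (tendsto_betaSqPrimitive_shift n ν)

theorem integral_betaSq_shift (n ν : ℕ) {a : ℝ} (ha : 0 < a) :
    ∫ t in Set.Ioi a, betaSq n (t + ν) = -betaSqPrimitive n (a + ν) := by
  rw [integral_Ioi_of_hasDerivAt_of_nonneg'
    (fun _ ht => hasDerivAt_betaSqPrimitive_shift n ν (ha.trans_le ht))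
    (fun t ht => (betaSq_pos n (by have := ha.trans ht; positivity)).le)
    (tendsto_betaSqPrimitive_shift n ν), zero_sub]

theorem betaSqPrimitive_neg (n : ℕ) {t : ℝ} (ht : 0 < t) : betaSqPrimitive n t < 0 := by
  have h := integral_betaSq_shift n 0 ht
  have hpos : 0 < ∫ s in Set.Ioi t, betaSq n (s + (0 : ℕ)) := by
    refine (setIntegral_pos_iff_support_of_nonneg_ae ?_ (integrableOn_betaSq_shift n 0 ht)).2 ?_
    · filter_upwards [ae_restrict_mem measurableSet_Ioi] with s hs
      exact (betaSq_pos n (by have : 0 < s := ht.trans hs; positivity)).le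
    · have : Function.support (fun s => betaSq n (s + (0 : ℕ))) ∩ Set.Ioi t = Set.Ioi t := by
        refine Set.inter_eq_right.2 fun s hs => ?_
        exact (betaSq_pos n (by have : 0 < s := ht.trans hs; positivity)).ne'
      rw [this]; simp
  rw [h] at hpos
  simpa using hpos

/-! ### The linear form in γ and logarithms -/

/-- The rational part of the linear form `sondowI n`. -/
noncomputable def sondowA (n : ℕ) : ℝ :=
  ∑ k ∈ Finset.range (n + 1), (n.choose k : ℝ) ^ 2 * (harmonic (n + k) : ℝ)

/-- The logarithmic part of the linear form `sondowI n`. -/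
noncomputable def sondowL (n : ℕ) : ℝ :=
  ∑ k ∈ Finset.range (n + 1), logCoeff n k * Real.log ((n + k).factorial : ℝ)

theorem tendsto_harmonic_add_sub_log (k : ℕ) :
    Tendsto (fun N : ℕ => (harmonic (N + k) : ℝ) - Real.log N) atTop
      (𝓝 Real.eulerMascheroniConstant) := by
  have h1 := Real.tendsto_harmonic_sub_log.comp (tendsto_add_atTop_nat k)
  have h2 := (tendsto_log_add_natCast_sub_log k).comp tendsto_natCast_atTop_atTop
  have h := h1.add h2
  rw [add_zero] at h
  refine h.congr fun N => ?_
  simp only [Function.comp_apply]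
  push_cast
  ring

theorem tendsto_log_factorial_add (k : ℕ) :
    Tendsto (fun N : ℕ => Real.log ((N + k).factorial : ℝ) - Real.log (N.factorial : ℝ) -
      k * Real.log N) atTop (𝓝 0) := by
  induction k with
  | zero => simp
  | succ k ih =>
    have h := ih.add ((tendsto_log_add_natCast_sub_log (k + 1)).comp
      (tendsto_natCast_atTop_atTop (R := ℝ)))
    rw [add_zero] at h
    refine h.congr fun N => ?_
    have h1 : ((N + k + 1 : ℕ) : ℝ) ≠ 0 := by positivity
    have h2 : ((N + k).factorial : ℝ) ≠ 0 := by positivity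
    rw [← add_assoc, Nat.factorial_succ, Nat.cast_mul, Real.log_mul h1 h2]
    simp only [Function.comp_apply]
    push_cast
    rw [add_assoc (N : ℝ)]
    ring

theorem sum_neg_betaSqPrimitive (n M : ℕ) :
    ∑ ν ∈ Finset.range M, -betaSqPrimitive n ((n : ℝ) + 1 + ν) =
      (∑ k ∈ Finset.range (n + 1), ((n.choose k : ℝ) ^ 2 * (harmonic (n + M + k) : ℝ) -
        logCoeff n k * Real.log ((n + M + k).factorial : ℝ))) - sondowA n + sondowL n := by
  induction M with
  | zero => simp [sondowA, sondowL, Finset.sum_sub_distrib]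
  | succ M ih =>
    rw [Finset.sum_range_succ, ih, betaSqPrimitive, ← Finset.sum_neg_distrib]
    have h : ∀ k ∈ Finset.range (n + 1),
        (n.choose k : ℝ) ^ 2 * (harmonic (n + (M + 1) + k) : ℝ) -
          logCoeff n k * Real.log ((n + (M + 1) + k).factorial : ℝ) =
        ((n.choose k : ℝ) ^ 2 * (harmonic (n + M + k) : ℝ) -
          logCoeff n k * Real.log ((n + M + k).factorial : ℝ)) +
        -(-((n.choose k : ℝ) ^ 2 / ((n : ℝ) + 1 + M + k)) +
          logCoeff n k * Real.log ((n : ℝ) + 1 + M + k)) := by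
      intro k _
      have h1 : ((n + M + k + 1 : ℕ) : ℝ) ≠ 0 := by positivity
      have h2 : ((n + M + k).factorial : ℝ) ≠ 0 := by positivity
      rw [show n + (M + 1) + k = n + M + k + 1 by ring, harmonic_succ, Nat.factorial_succ,
        Nat.cast_mul, Real.log_mul h1 h2]
      push_cast
      rw [show (n : ℝ) + M + k + 1 = n + 1 + M + k by ring]
      ring
    rw [Finset.sum_congr rfl h, Finset.sum_add_distrib]
    ring

theorem hasSum_neg_betaSqPrimitive {n : ℕ} (hn : n ≠ 0) :
    HasSum (fun ν : ℕ => -betaSqPrimitive n ((n : ℝ) + 1 + ν))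
      (n.centralBinom * Real.eulerMascheroniConstant - sondowA n + sondowL n) := by
  rw [hasSum_iff_tendsto_nat_of_nonneg
    fun ν => neg_nonneg.2 (betaSqPrimitive_neg n (by positivity)).le]
  simp only [sum_neg_betaSqPrimitive]
  refine Tendsto.add_const _ (Tendsto.sub_const ?_ _)
  have h (k : ℕ) := ((tendsto_harmonic_add_sub_log k).const_mul ((n.choose k : ℝ) ^ 2)).sub
    ((tendsto_log_factorial_add k).const_mul (logCoeff n k))
  have hs := tendsto_finsetSum (Finset.range (n + 1)) fun k _ => h k
  simp only [mul_zero, sub_zero, ← Finset.sum_mul, sum_choose_sq] at hs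
  refine (hs.comp (tendsto_add_atTop_nat n)).congr fun M => ?_
  simp only [Function.comp_apply, add_comm M n]
  have key : ∀ k ∈ Finset.range (n + 1),
      (n.choose k : ℝ) ^ 2 * ((harmonic (n + M + k) : ℝ) - Real.log ((n + M : ℕ) : ℝ)) -
        logCoeff n k * (Real.log ((n + M + k).factorial : ℝ) -
          Real.log ((n + M).factorial : ℝ) - k * Real.log ((n + M : ℕ) : ℝ)) =
      ((n.choose k : ℝ) ^ 2 * (harmonic (n + M + k) : ℝ) -
        logCoeff n k * Real.log ((n + M + k).factorial : ℝ)) +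
      (logCoeff n k * Real.log ((n + M).factorial : ℝ) +
        (k * logCoeff n k * Real.log ((n + M : ℕ) : ℝ) -
        (n.choose k : ℝ) ^ 2 * Real.log ((n + M : ℕ) : ℝ))) := by
    intro k _; ring
  rw [Finset.sum_congr rfl key, Finset.sum_add_distrib, Finset.sum_add_distrib,
    Finset.sum_sub_distrib (f := fun k : ℕ => (k : ℝ) * logCoeff n k * Real.log ((n + M : ℕ) : ℝ)),
    ← Finset.sum_mul, ← Finset.sum_mul, ← Finset.sum_mul, sum_logCoeff, sum_mul_logCoeff hn,
    sum_choose_sq]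
  ring

theorem hasSum_integral_sondowIntegrand {n : ℕ} (hn : n ≠ 0) :
    HasSum (fun ν : ℕ => -betaSqPrimitive n ((n : ℝ) + 1 + ν)) (sondowI n) := by
  have ha : (0 : ℝ) < (n : ℝ) + 1 := by positivity
  have hn1 : (1 : ℝ) ≤ n := by exact_mod_cast Nat.one_le_iff_ne_zero.2 hn
  have h := hasSum_integral_of_summable_integral_norm
    (μ := volume.restrict (Set.Ioi ((n : ℝ) + 1)))
    (F := fun (ν : ℕ) t => betaSq n (t + ν)) (fun ν => integrableOn_betaSq_shift n ν ha) ?_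
  · simp only [integral_betaSq_shift n _ ha] at h
    rw [sondowI]
    convert! h using 1
    refine setIntegral_congr_fun measurableSet_Ioi fun t ht => ?_
    exact sondowIntegrand_eq_tsum n (by have : (n : ℝ) + 1 < t := ht; linarith)
  · have hnorm (ν : ℕ) : ∫ t in Set.Ioi ((n : ℝ) + 1), ‖betaSq n (t + ν)‖ =
        -betaSqPrimitive n ((n : ℝ) + 1 + ν) := by
      rw [← integral_betaSq_shift n ν ha]
      refine setIntegral_congr_fun measurableSet_Ioi fun t ht => ?_
      exact Real.norm_of_nonneg (betaSq_pos n (by have : 0 < t := ha.trans ht; positivity)).le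
    simp only [hnorm]
    exact (hasSum_neg_betaSqPrimitive hn).summable

theorem sondowI_eq {n : ℕ} (hn : n ≠ 0) :
    sondowI n = n.centralBinom * Real.eulerMascheroniConstant - sondowA n + sondowL n :=
  (hasSum_integral_sondowIntegrand hn).unique (hasSum_neg_betaSqPrimitive hn)

theorem sondowI_pos {n : ℕ} (hn : n ≠ 0) : 0 < sondowI n := by
  rw [← (hasSum_integral_sondowIntegrand hn).tsum_eq]
  exact (hasSum_integral_sondowIntegrand hn).summable.tsum_pos
    (fun ν => neg_nonneg.2 (betaSqPrimitive_neg n (by positivity)).le) 0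
    (neg_pos.2 (betaSqPrimitive_neg n (by positivity)))

theorem integrableOn_sondowIntegrand {n : ℕ} (hn : n ≠ 0) :
    IntegrableOn (sondowIntegrand n) (Set.Ioi ((n : ℝ) + 1)) :=
  -- The Bochner integral of a non-integrable function is zero by convention, so positivity of the
  -- integral proves convergence.
  Integrable.of_integral_ne_zero (sondowI_pos hn).ne'

/-! ### The logarithmic part is log S_n / d_{2n} -/

theorem harmonic_add_sum_Icc {k N : ℕ} (h : k ≤ N) :
    (harmonic k : ℝ) + ∑ j ∈ Finset.Icc (k + 1) N, (1 : ℝ) / j = harmonic N := by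
  induction N, h using Nat.le_induction with
  | base => simp
  | succ N hN ih =>
    rw [Finset.sum_Icc_succ_top (by omega), ← add_assoc, ih, harmonic_succ]
    push_cast; ring

theorem sum_exponent_eq {n k : ℕ} (hk : k ≤ n - k) (x : ℝ) :
    ∑ j ∈ Finset.Icc (k + 1) (n - k),
      ((n.choose k ^ 2 * (2 * lcmUpTo (2 * n) / j) : ℕ) : ℝ) * x =
      -(lcmUpTo (2 * n) * (x * logCoeff n k)) := by
  have hterm : ∀ j ∈ Finset.Icc (k + 1) (n - k),
      ((n.choose k ^ 2 * (2 * lcmUpTo (2 * n) / j) : ℕ) : ℝ) * x =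
        (2 * (n.choose k : ℝ) ^ 2 * lcmUpTo (2 * n) * x) * (1 / j) := by
    intro j hj
    obtain ⟨h1, h2⟩ := Finset.mem_Icc.1 hj
    have hdvd : j ∣ 2 * lcmUpTo (2 * n) :=
      (dvd_lcmUpTo (by omega) (by omega)).mul_left 2
    have hj0 : (j : ℝ) ≠ 0 := Nat.cast_ne_zero.2 (by omega)
    rw [Nat.cast_mul, Nat.cast_div hdvd hj0]
    push_cast
    ring
  rw [Finset.sum_congr rfl hterm, ← Finset.mul_sum, logCoeff, ← harmonic_add_sum_Icc hk]
  ring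

theorem sum_logCoeff_Ico (n m : ℕ) (hm : m ≤ n) :
    ∑ k ∈ Finset.Ico (n - m + 1) m, logCoeff n k = 0 := by
  refine self_eq_neg.1 ?_
  rw [← Finset.sum_neg_distrib]
  refine Finset.sum_nbij' (fun k => n - k) (fun k => n - k) ?_ ?_ ?_ ?_ ?_
  · intro k hk; rw [Finset.mem_Ico] at *; omega
  · intro k hk; rw [Finset.mem_Ico] at *; omega
  · intro k hk; rw [Finset.mem_Ico] at *; omega
  · intro k hk; rw [Finset.mem_Ico] at *; omega
  · intro k hk
    rw [Finset.mem_Ico] at hk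
    rw [logCoeff_reflect (by omega), neg_neg]

/-- The indices dropped by the minimum form a block symmetric under `k ↦ n - k`, where the
coefficients cancel. Those kept satisfy `k ≤ n - k`, so the harmonic difference is minus a sum of `1
/ j`, giving positive exponents. -/
theorem sum_logCoeff_min {n m : ℕ} (hm1 : 1 ≤ m) (hm : m ≤ n) :
    ∑ k ∈ Finset.Icc 0 (min (m - 1) (n - m)), logCoeff n k =
      ∑ k ∈ Finset.range m, logCoeff n k := by
  rw [← Nat.range_succ_eq_Icc_zero]
  rcases le_total (m - 1) (n - m) with h | h
  · rw [min_eq_left h, Nat.sub_add_cancel hm1]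
  · rw [min_eq_right h, ← Finset.sum_range_add_sum_Ico _ (show n - m + 1 ≤ m by omega),
      sum_logCoeff_Ico n m hm, add_zero]

theorem log_factorial_add (n k : ℕ) :
    Real.log ((n + k).factorial : ℝ) =
      Real.log (n.factorial : ℝ) + ∑ m ∈ Finset.Icc 1 k, Real.log ((n + m : ℕ) : ℝ) := by
  induction k with
  | zero => simp
  | succ k ih =>
    have h1 : ((n + k + 1 : ℕ) : ℝ) ≠ 0 := by positivity
    have h2 : ((n + k).factorial : ℝ) ≠ 0 := by positivity
    rw [Finset.sum_Icc_succ_top (by omega), ← add_assoc, ← add_assoc, ← ih, Nat.factorial_succ,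
      Nat.cast_mul, Real.log_mul h1 h2, add_comm]

theorem sum_logCoeff_ge (n m : ℕ) (hm : m ≤ n) :
    ∑ k ∈ Finset.range (n + 1), (if m ≤ k then logCoeff n k else 0) =
      -∑ k ∈ Finset.range m, logCoeff n k := by
  have h := Finset.sum_range_add_sum_Ico (logCoeff n) (show m ≤ n + 1 by omega)
  rw [sum_logCoeff] at h
  rw [← eq_neg_of_add_eq_zero_right h, ← Finset.sum_filter]
  congr 1
  ext k
  simp only [Finset.mem_filter, Finset.mem_range, Finset.mem_Ico]
  omega

/-- Abel summation; tail sums become negated initial sums because the coefficients add up to zero.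
-/
theorem sondowL_eq (n : ℕ) :
    sondowL n = ∑ m ∈ Finset.Icc 1 n,
      -(Real.log ((n + m : ℕ) : ℝ) * ∑ k ∈ Finset.range m, logCoeff n k) := by
  have h : ∀ k ∈ Finset.range (n + 1),
      logCoeff n k * Real.log ((n + k).factorial : ℝ) =
        logCoeff n k * Real.log (n.factorial : ℝ) + ∑ m ∈ Finset.Icc 1 n,
          Real.log ((n + m : ℕ) : ℝ) * (if m ≤ k then logCoeff n k else 0) := by
    intro k hk
    have hk' := Finset.mem_range.1 hk
    rw [log_factorial_add, mul_add, Finset.mul_sum]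
    congr 1
    rw [← Finset.sum_subset (Finset.Icc_subset_Icc_right (show k ≤ n by omega))]
    · refine Finset.sum_congr rfl fun m hm => ?_
      rw [if_pos (Finset.mem_Icc.1 hm).2, mul_comm]
    · intro m hm hmk
      rw [if_neg, mul_zero]
      rw [Finset.mem_Icc] at hm hmk
      omega
  rw [sondowL, Finset.sum_congr rfl h, Finset.sum_add_distrib, ← Finset.sum_mul, sum_logCoeff,
    zero_mul, zero_add, Finset.sum_comm]
  refine Finset.sum_congr rfl fun m hm => ?_
  rw [← Finset.mul_sum, sum_logCoeff_ge n m (Finset.mem_Icc.1 hm).2, mul_neg]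

theorem log_sondowS (n : ℕ) :
    Real.log (sondowS n : ℝ) = lcmUpTo (2 * n) * sondowL n := by
  rw [sondowS, sondowL_eq, Finset.mul_sum, Nat.cast_prod, Real.log_prod]
  · refine Finset.sum_congr rfl fun m hm => ?_
    obtain ⟨hm1, hm2⟩ := Finset.mem_Icc.1 hm
    have hne : ((n + m : ℕ) : ℝ) ≠ 0 := by positivity
    rw [Nat.cast_prod, Real.log_prod (fun k _ => by positivity), ← sum_logCoeff_min hm1 hm2,
      Finset.mul_sum, ← Finset.sum_neg_distrib, Finset.mul_sum]
    refine Finset.sum_congr rfl fun k hk => ?_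
    have hk' := (Finset.mem_Icc.1 hk).2
    rw [Nat.cast_prod, Real.log_prod (fun j _ => by positivity), mul_neg,
      ← sum_exponent_eq (by omega)]
    refine Finset.sum_congr rfl fun j _ => ?_
    rw [Nat.cast_pow, Real.log_pow]
  · intro m hm
    have := (Finset.mem_Icc.1 hm).1
    positivity

/-! ### Clearing denominators and the arithmetic criterion -/

theorem exists_int_lcmUpTo_mul_harmonic {N j : ℕ} (h : j ≤ N) :
    ∃ z : ℤ, (lcmUpTo N : ℝ) * (harmonic j : ℝ) = z := by
  induction j with
  | zero => exact ⟨0, by simp⟩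
  | succ j ih =>
    obtain ⟨z, hz⟩ := ih (by omega)
    obtain ⟨c, hc⟩ := dvd_lcmUpTo (show 1 ≤ j + 1 by omega) h
    refine ⟨z + c, ?_⟩
    have hj : (j : ℝ) + 1 ≠ 0 := by positivity
    rw [harmonic_succ]
    push_cast
    rw [mul_add, hz, hc]
    push_cast
    field_simp

theorem exists_int_lcmUpTo_mul_sondowA (n : ℕ) :
    ∃ z : ℤ, (lcmUpTo (2 * n) : ℝ) * sondowA n = z := by
  have h : ∀ k ∈ Finset.range (n + 1), ∃ z : ℤ,
      (lcmUpTo (2 * n) : ℝ) * ((n.choose k : ℝ) ^ 2 * (harmonic (n + k) : ℝ)) = z := by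
    intro k hk
    obtain ⟨z, hz⟩ := exists_int_lcmUpTo_mul_harmonic
      (show n + k ≤ 2 * n by have := Finset.mem_range.1 hk; omega)
    exact ⟨n.choose k ^ 2 * z, by push_cast; rw [mul_left_comm, hz]⟩
  choose! z hz using h
  refine ⟨∑ k ∈ Finset.range (n + 1), z k, ?_⟩
  rw [sondowA, Finset.mul_sum, Finset.sum_congr rfl hz, Int.cast_sum]

theorem lcmUpTo_pos (N : ℕ) : 0 < lcmUpTo N :=
  Nat.lcmUpto_pos N

theorem exists_int_lcmUpTo_mul_sondowI {n : ℕ} (hn : n ≠ 0) :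
    ∃ z : ℤ, (lcmUpTo (2 * n) : ℝ) * sondowI n =
      ((lcmUpTo (2 * n) * n.centralBinom : ℕ) : ℝ) * Real.eulerMascheroniConstant +
        Real.log (sondowS n : ℝ) - z := by
  obtain ⟨z, hz⟩ := exists_int_lcmUpTo_mul_sondowA n
  refine ⟨z, ?_⟩
  rw [log_sondowS, ← hz, sondowI_eq hn]
  push_cast
  ring

theorem eulerMascheroniConstant_rational_of_fract {n : ℕ} (hn : n ≠ 0)
    (h : Int.fract (Real.log (sondowS n : ℝ)) = (lcmUpTo (2 * n) : ℝ) * sondowI n) :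
    ∃ q : ℚ, Real.eulerMascheroniConstant = (q : ℝ) := by
  obtain ⟨z, hz⟩ := exists_int_lcmUpTo_mul_sondowI hn
  have hpos : ((lcmUpTo (2 * n) * n.centralBinom : ℕ) : ℝ) ≠ 0 :=
    Nat.cast_ne_zero.2 (Nat.mul_pos (lcmUpTo_pos _) n.centralBinom_pos).ne'
  refine ⟨(z - ⌊Real.log (sondowS n : ℝ)⌋ : ℚ) / (lcmUpTo (2 * n) * n.centralBinom : ℕ), ?_⟩
  rw [← h, Int.fract] at hz
  rw [Rat.cast_div, Rat.cast_natCast, eq_div_iff hpos]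
  push_cast at hz ⊢
  linarith

theorem fract_log_sondowS_of_rational {q : ℚ} (hq : Real.eulerMascheroniConstant = (q : ℝ)) {n : ℕ}
    (hn : n ≠ 0) (hden : q.den ≤ 2 * n) (hlt : (lcmUpTo (2 * n) : ℝ) * sondowI n < 1) :
    Int.fract (Real.log (sondowS n : ℝ)) = (lcmUpTo (2 * n) : ℝ) * sondowI n := by
  obtain ⟨z, hz⟩ := exists_int_lcmUpTo_mul_sondowI hn
  obtain ⟨c, hc⟩ := dvd_lcmUpTo q.pos hden
  have hden0 : (q.den : ℝ) ≠ 0 := Nat.cast_ne_zero.2 q.den_nz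
  have hint : ((lcmUpTo (2 * n) * n.centralBinom : ℕ) : ℝ) * (q : ℝ) =
      ((c * n.centralBinom * q.num : ℤ) : ℝ) := by
    rw [hc, Rat.cast_def]
    push_cast
    field_simp
  rw [hq, hint] at hz
  refine Int.fract_eq_iff.2 ⟨mul_nonneg (Nat.cast_nonneg _) (sondowI_pos hn).le, hlt,
    z - c * n.centralBinom * q.num, ?_⟩
  rw [hz]
  push_cast
  ring

/-! ### A Chebyshev bound from (6n)! n! / ((3n)! (2n)!²) -/

theorem mul_div_eq_of_mod (k n : ℕ) {q : ℕ} (hq : 0 < q) :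
    k * n / q = k * (n / q) + k * (n % q) / q := by
  conv_lhs => rw [← Nat.div_add_mod n q, mul_add, mul_left_comm]
  rw [Nat.mul_add_div hq]

/-- Since 3 + 2·2 = 6 + 1, multiples of `q` cancel and only the residue of `n` matters, leaving
finitely many cases. -/
theorem three_mul_div_add_le (n : ℕ) {q : ℕ} (hq : 0 < q) :
    3 * n / q + 2 * (2 * n / q) ≤ 6 * n / q + n / q := by
  have hr := Nat.mod_lt n hq
  rw [mul_div_eq_of_mod 3 n hq, mul_div_eq_of_mod 2 n hq, mul_div_eq_of_mod 6 n hq]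
  generalize n % q = r at *
  have h6 : 6 * r / q < 6 := (Nat.div_lt_iff_lt_mul hq).2 (by omega)
  have h3 : 3 * r / q < 3 := (Nat.div_lt_iff_lt_mul hq).2 (by omega)
  have h2 : 2 * r / q < 2 := (Nat.div_lt_iff_lt_mul hq).2 (by omega)
  have a6 := Nat.lt_mul_div_succ (6 * r) hq
  have a3 := Nat.mul_div_le (3 * r) q
  have a2 := Nat.mul_div_le (2 * r) q
  generalize 6 * r / q = x at *
  generalize 3 * r / q = y at *
  generalize 2 * r / q = z at *
  interval_cases x <;> interval_cases y <;> interval_cases z <;> omega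

theorem three_mul_div_add_lt {n q : ℕ} (h1 : 2 * n < q) (h2 : q ≤ 6 * n) :
    3 * n / q + 2 * (2 * n / q) < 6 * n / q + n / q := by
  have hq : 0 < q := by omega
  rw [Nat.div_eq_of_lt h1, Nat.div_eq_of_lt (show n < q by omega)]
  have h3 : 3 * n / q < 2 := (Nat.div_lt_iff_lt_mul hq).2 (by omega)
  rcases lt_or_ge (3 * n) q with h | h
  · rw [Nat.div_eq_of_lt h]
    have : 0 < 6 * n / q := Nat.div_pos h2 hq
    omega
  · have : 2 ≤ 6 * n / q := (Nat.le_div_iff_mul_le hq).2 (by omega)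
    omega

theorem factorization_factorial_le {n p : ℕ} (hp : p.Prime) :
    (3 * n).factorial.factorization p + 2 * (2 * n).factorial.factorization p ≤
      (6 * n).factorial.factorization p + n.factorial.factorization p := by
  have hlog {m : ℕ} (hm : m ≤ 6 * n) : Nat.log p m < Nat.log p (6 * n) + 1 :=
    Nat.lt_succ_of_le (Nat.log_mono_right hm)
  rw [Nat.factorization_factorial hp (hlog (by omega)),
    Nat.factorization_factorial hp (hlog (by omega)), Nat.factorization_factorial hp (hlog le_rfl),
    Nat.factorization_factorial hp (hlog (by omega)), Finset.mul_sum, ← Finset.sum_add_distrib,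
    ← Finset.sum_add_distrib]
  exact Finset.sum_le_sum fun i _ => three_mul_div_add_le n (pow_pos hp.pos i)

theorem factorization_factorial_lt {n p : ℕ} (hp : p.Prime) (h1 : 2 * n < p) (h2 : p ≤ 6 * n) :
    (3 * n).factorial.factorization p + 2 * (2 * n).factorial.factorization p <
      (6 * n).factorial.factorization p + n.factorial.factorization p := by
  have hlog {m : ℕ} (hm : m ≤ 6 * n) : Nat.log p m < Nat.log p (6 * n) + 1 :=
    Nat.lt_succ_of_le (Nat.log_mono_right hm)
  rw [Nat.factorization_factorial hp (hlog (by omega)),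
    Nat.factorization_factorial hp (hlog (by omega)), Nat.factorization_factorial hp (hlog le_rfl),
    Nat.factorization_factorial hp (hlog (by omega)), Finset.mul_sum, ← Finset.sum_add_distrib,
    ← Finset.sum_add_distrib]
  refine Finset.sum_lt_sum (fun i _ => three_mul_div_add_le n (pow_pos hp.pos i))
    ⟨1, Finset.mem_Ico.2 ⟨le_rfl, ?_⟩, ?_⟩
  · have := Nat.log_pos hp.one_lt h2
    omega
  · simpa using three_mul_div_add_lt h1 h2

theorem factorization_three_two_factorial (n p : ℕ) :
    ((3 * n).factorial * (2 * n).factorial ^ 2).factorization p =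
      (3 * n).factorial.factorization p + 2 * (2 * n).factorial.factorization p := by
  rw [Nat.factorization_mul (Nat.factorial_ne_zero _) (pow_ne_zero _ (Nat.factorial_ne_zero _)),
    Nat.factorization_pow]
  simp

theorem factorization_six_one_factorial (n p : ℕ) :
    ((6 * n).factorial * n.factorial).factorization p =
      (6 * n).factorial.factorization p + n.factorial.factorization p := by
  rw [Nat.factorization_mul (Nat.factorial_ne_zero _) (Nat.factorial_ne_zero _)]
  simp

theorem three_two_factorial_dvd (n : ℕ) :
    (3 * n).factorial * (2 * n).factorial ^ 2 ∣ (6 * n).factorial * n.factorial := by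
  rw [← Nat.factorization_prime_le_iff_dvd (by positivity) (by positivity)]
  intro p hp
  rw [factorization_three_two_factorial, factorization_six_one_factorial]
  exact factorization_factorial_le hp

/-- The factor 108 is 6⁶ / (3³ · 2⁴), the limiting ratio of consecutive quotients, and it bounds
every such ratio. -/
theorem six_one_factorial_le (n : ℕ) :
    (6 * n).factorial * n.factorial ≤ 108 ^ n * ((3 * n).factorial * (2 * n).factorial ^ 2) := by
  induction n with
  | zero => simp
  | succ n ih =>
    rw [show 6 * (n + 1) = 6 * n + 1 + 1 + 1 + 1 + 1 + 1 by ring,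
      show 3 * (n + 1) = 3 * n + 1 + 1 + 1 by ring, show 2 * (n + 1) = 2 * n + 1 + 1 by ring]
    simp only [Nat.factorial_succ, pow_succ 108]
    have hpoly : (6 * n + 1 + 1 + 1 + 1 + 1 + 1) * (6 * n + 1 + 1 + 1 + 1 + 1) *
        (6 * n + 1 + 1 + 1 + 1) * (6 * n + 1 + 1 + 1) * (6 * n + 1 + 1) * (6 * n + 1) * (n + 1) ≤
        108 * ((3 * n + 1 + 1 + 1) * (3 * n + 1 + 1) * (3 * n + 1) *
          ((2 * n + 1 + 1) * (2 * n + 1)) ^ 2) := by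
      have : 6 * (6 * n + 1) * (6 * n + 5) ≤ 108 * ((2 * n + 1) * (n + 1)) := by nlinarith
      calc _ = ((3 * n + 3) * (3 * n + 2) * (3 * n + 1) * (4 * (2 * n + 1) * (n + 1))) *
            (6 * (6 * n + 1) * (6 * n + 5)) := by ring
        _ ≤ ((3 * n + 3) * (3 * n + 2) * (3 * n + 1) * (4 * (2 * n + 1) * (n + 1))) *
            (108 * ((2 * n + 1) * (n + 1))) := by gcongr
        _ = _ := by ring
    calc _ = ((6 * n + 1 + 1 + 1 + 1 + 1 + 1) * (6 * n + 1 + 1 + 1 + 1 + 1) *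
        (6 * n + 1 + 1 + 1 + 1) * (6 * n + 1 + 1 + 1) * (6 * n + 1 + 1) * (6 * n + 1) * (n + 1)) *
          ((6 * n).factorial * n.factorial) := by ring
      _ ≤ (108 * ((3 * n + 1 + 1 + 1) * (3 * n + 1 + 1) * (3 * n + 1) *
          ((2 * n + 1 + 1) * (2 * n + 1)) ^ 2)) *
          (108 ^ n * ((3 * n).factorial * (2 * n).factorial ^ 2)) := by gcongr
      _ = _ := by ring

theorem prod_primes_Ioc_le (n : ℕ) :
    ∏ p ∈ (Finset.Ioc (2 * n) (6 * n)).filter Nat.Prime, p ≤ 108 ^ n := by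
  obtain ⟨D, hD⟩ := three_two_factorial_dvd n
  have hpos : 0 < (3 * n).factorial * (2 * n).factorial ^ 2 := by positivity
  have hD0 : D ≠ 0 := by
    rintro rfl
    have : 0 < (6 * n).factorial * n.factorial := by positivity
    omega
  have hle : D ≤ 108 ^ n := by
    have h := six_one_factorial_le n
    rw [hD, mul_comm (108 ^ n)] at h
    exact Nat.le_of_mul_le_mul_left h hpos
  refine (Nat.le_of_dvd (Nat.pos_of_ne_zero hD0) ?_).trans hle
  refine Finset.prod_primes_dvd D (fun p hp => (Finset.mem_filter.1 hp).2.prime) fun p hp => ?_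
  obtain ⟨hp1, hp⟩ := Finset.mem_filter.1 hp
  obtain ⟨h1, h2⟩ := Finset.mem_Ioc.1 hp1
  have h := factorization_factorial_lt hp h1 h2
  rw [← factorization_three_two_factorial, ← factorization_six_one_factorial, hD,
    Nat.factorization_mul hpos.ne' hD0, Finsupp.add_apply] at h
  exact Nat.dvd_of_factorization_pos (by omega)

theorem theta_six_mul_le (n : ℕ) :
    Chebyshev.theta ((6 * n : ℕ) : ℝ) ≤
      Chebyshev.theta ((2 * n : ℕ) : ℝ) + n * Real.log 108 := by
  have h : Chebyshev.theta ((6 * n : ℕ) : ℝ) = Chebyshev.theta ((2 * n : ℕ) : ℝ) +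
      Real.log ((∏ p ∈ (Finset.Ioc (2 * n) (6 * n)).filter Nat.Prime, p : ℕ) : ℝ) := by
    rw [Nat.cast_prod, Real.log_prod
      (fun p hp => Nat.cast_ne_zero.2 (Finset.mem_filter.1 hp).2.ne_zero)]
    simp only [Chebyshev.theta, Nat.floor_natCast]
    rw [← Finset.sum_union]
    · congr 1
      rw [← Finset.filter_union, Finset.Ioc_union_Ioc_eq_Ioc (by omega) (by omega)]
    · exact Finset.disjoint_filter_filter (Finset.Ioc_disjoint_Ioc_of_le le_rfl)
  have hpos : 0 < ∏ p ∈ (Finset.Ioc (2 * n) (6 * n)).filter Nat.Prime, p :=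
    Finset.prod_pos fun p hp => (Finset.mem_filter.1 hp).2.pos
  rw [h, ← Real.log_pow]
  gcongr
  exact_mod_cast prod_primes_Ioc_le n

theorem log_108_le : Real.log 108 ≤ 4.7 := by
  rw [Real.log_le_iff_le_exp (by norm_num)]
  have h := Real.exp_one_gt_d9
  calc (108 : ℝ) ≤ (2.7182818283 : ℝ) ^ 4 * 2.0 := by norm_num
    _ ≤ Real.exp 1 ^ 4 * Real.exp 0.7 := by
      gcongr
      have h2 := Real.log_two_lt_d9
      rw [← Real.log_le_iff_le_exp (by norm_num)]
      norm_num at h2 ⊢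
      linarith
    _ = Real.exp 4.7 := by
      rw [← Real.exp_nat_mul, ← Real.exp_add]; norm_num

theorem exists_theta_le : ∃ K : ℝ, ∀ N : ℕ, Chebyshev.theta (N : ℝ) ≤ 1.3 * N + K := by
  -- Strong induction from `N` to `2n`, with `n` the ceiling of `N / 6`: the bound becomes (2.6 +
  -- 4.7) n + K, and 7.3 (N + 5) / 6 ≤ 1.3 N once `N ≥ 73`, so the threshold 80 suffices.
  refine ⟨Chebyshev.theta ((80 : ℕ) : ℝ), fun N => ?_⟩
  induction N using Nat.strong_induction_on with
  | _ N ih =>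
    rcases le_or_gt N 80 with hN | hN
    · have h1 := Chebyshev.theta_mono (show (N : ℝ) ≤ (80 : ℕ) by exact_mod_cast hN)
      exact h1.trans (le_add_of_nonneg_left (by positivity))
    · obtain ⟨n, hn1, hn2⟩ : ∃ n, N ≤ 6 * n ∧ 6 * n ≤ N + 5 := ⟨(N + 5) / 6, by omega, by omega⟩
      have h1 := Chebyshev.theta_mono (show (N : ℝ) ≤ (6 * n : ℕ) by exact_mod_cast hn1)
      have h2 := theta_six_mul_le n
      have h3 := ih (2 * n) (by omega)
      have h4 : (6 : ℝ) * n ≤ N + 5 := by exact_mod_cast hn2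
      have h5 : (80 : ℝ) ≤ N := by exact_mod_cast hN.le
      have h6 : (n : ℝ) * Real.log 108 ≤ n * 4.7 := by gcongr; exact log_108_le
      push_cast at h1 h2 h3
      norm_num at h3 h6 ⊢
      linarith

theorem exists_lcmUpTo_le : ∃ K C : ℝ, ∀ N : ℕ,
    (lcmUpTo N : ℝ) ≤ Real.exp (1.3 * N + C * √N + K) := by
  obtain ⟨K, hK⟩ := exists_theta_le
  obtain ⟨C, hC⟩ := Chebyshev.psi_sub_theta_le_mul_sqrt
  refine ⟨K, C, fun N => ?_⟩
  rw [← Real.log_le_iff_le_exp (Nat.cast_pos.2 (lcmUpTo_pos N))]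
  have h := Chebyshev.psi_eq_log_lcmUpto N
  have h' : Real.log (lcmUpTo N : ℝ) = Chebyshev.psi N := h.symm
  rw [h']
  linarith [hK N, hC N]

/-! ### Decay of I_n and of d_{2n} I_n -/

/-- The first two factors are bounded below by `t`, to keep decay in `t` for the integral and the
sum over ν; the others are bounded below by their values at `t = n + 1`, which yields the factor of
order 4^n. -/
theorem sq_mul_le_risingProd {n : ℕ} (hn : n ≠ 0) {t : ℝ} (ht : (n : ℝ) + 1 ≤ t) :
    t ^ 2 * ((2 * n + 1).factorial / (n + 2).factorial) ≤ risingProd (n + 1) t := by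
  obtain ⟨m, rfl⟩ := Nat.exists_eq_succ_of_ne_zero hn
  have ht0 : 0 < t := lt_of_lt_of_le (by positivity) ht
  have h := risingProd_natCast_add_one (m + 1 + 2) m
  have h2 : risingProd m (((m + 1 + 2 : ℕ) : ℝ) + 1) ≤ risingProd m (t + 1 + 1) :=
    risingProd_mono m (by positivity) (by push_cast at ht ⊢; linarith)
  rw [h, show m + 1 + 2 + m = 2 * (m + 1) + 1 by ring] at h2
  rw [Nat.succ_eq_add_one, risingProd_succ', risingProd_succ', sq, mul_assoc]
  gcongr
  linarith

theorem betaSq_le {n : ℕ} (hn : n ≠ 0) {t : ℝ} (ht : (n : ℝ) + 1 ≤ t) :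
    betaSq n t ≤ (((n : ℝ) + 1) * (n + 2)) ^ 2 / 16 ^ n * (t ^ 3)⁻¹ := by
  have ht1 : 1 ≤ t := by linarith [(Nat.cast_nonneg n : (0 : ℝ) ≤ n)]
  have h1 := sq_mul_le_risingProd hn ht
  have hcb : (4 : ℝ) ^ n ≤ 2 * n * n.centralBinom := by
    exact_mod_cast Nat.four_pow_le_two_mul_self_mul_centralBinom n (Nat.pos_of_ne_zero hn)
  have hfac : ((2 * n + 1).factorial : ℝ) =
      (2 * n + 1) * (n.centralBinom * n.factorial * n.factorial) := by
    have h := Nat.choose_mul_factorial_mul_factorial (show n ≤ 2 * n by omega)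
    rw [show 2 * n - n = n by omega] at h
    rw [Nat.factorial_succ, ← h, Nat.centralBinom]
    push_cast; ring
  have hfac2 : ((n + 2).factorial : ℝ) = (n + 2) * (n + 1) * n.factorial := by
    rw [Nat.factorial_succ, Nat.factorial_succ]
    push_cast; ring
  have hb : (n.factorial : ℝ) / risingProd (n + 1) t ≤ ((n : ℝ) + 1) * (n + 2) / 4 ^ n / t ^ 2 := by
    have hpos : 0 < t ^ 2 * (((2 * n + 1).factorial : ℝ) / (n + 2).factorial) := by positivity
    refine (div_le_div_of_nonneg_left (by positivity) hpos h1).trans ?_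
    have hcb0 : (0 : ℝ) < n.centralBinom := Nat.cast_pos.2 n.centralBinom_pos
    rw [hfac, hfac2, div_div, div_le_div_iff₀ (by positivity) (by positivity)]
    have h4 : (4 : ℝ) ^ n ≤ (2 * n + 1) * n.centralBinom := by linarith
    calc (n.factorial : ℝ) * (4 ^ n * t ^ 2)
        ≤ n.factorial * (((2 * n + 1) * n.centralBinom) * t ^ 2) := by gcongr
      _ = _ := by field_simp
  have hbp : 0 ≤ (n.factorial : ℝ) / risingProd (n + 1) t :=
    div_nonneg (by positivity) (risingProd_pos _ (by linarith)).le
  have h16 : (16 : ℝ) ^ n = (4 ^ n) ^ 2 := by rw [← pow_mul, mul_comm, pow_mul]; norm_num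
  calc betaSq n t ≤ (((n : ℝ) + 1) * (n + 2) / 4 ^ n / t ^ 2) ^ 2 := pow_le_pow_left₀ hbp hb 2
    _ = (((n : ℝ) + 1) * (n + 2)) ^ 2 / 16 ^ n * (t ^ 4)⁻¹ := by rw [h16]; field_simp
    _ ≤ _ := by gcongr; norm_num

theorem neg_betaSqPrimitive_le {n : ℕ} (hn : n ≠ 0) {a : ℝ} (ha : (n : ℝ) + 1 ≤ a) :
    -betaSqPrimitive n a ≤ (((n : ℝ) + 1) * (n + 2)) ^ 2 / 16 ^ n * (1 / a ^ 2) := by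
  have ha0 : 0 < a := lt_of_lt_of_le (by positivity) ha
  have h := integral_betaSq_shift n 0 ha0
  simp only [Nat.cast_zero, add_zero] at h
  have hcube {t : ℝ} (ht : 0 < t) : t ^ (-3 : ℝ) = (t ^ 3)⁻¹ := by
    rw [Real.rpow_neg ht.le]; norm_cast
  have hint := integral_Ioi_rpow_of_lt (show (-3 : ℝ) < -1 by norm_num) ha0
  have hle : ∫ t in Set.Ioi a, betaSq n t ≤
      ∫ t in Set.Ioi a, (((n : ℝ) + 1) * (n + 2)) ^ 2 / 16 ^ n * t ^ (-3 : ℝ) := by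
    refine setIntegral_mono_on (by simpa using integrableOn_betaSq_shift n 0 ha0)
      ((integrableOn_Ioi_rpow_of_lt (by norm_num) ha0).const_mul _) measurableSet_Ioi
      fun t ht => ?_
    have ht' : a < t := ht
    rw [hcube (ha0.trans ht')]
    exact betaSq_le hn (ha.trans ht'.le)
  rw [h, integral_const_mul, hint] at hle
  refine hle.trans (mul_le_mul_of_nonneg_left ?_ (by positivity))
  have hsq : a ^ (-3 + 1 : ℝ) = 1 / a ^ 2 := by
    rw [show (-3 + 1 : ℝ) = -(2 : ℕ) by norm_num, Real.rpow_neg ha0.le, Real.rpow_natCast, one_div]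
  rw [hsq, show (-3 + 1 : ℝ) = -2 by norm_num, neg_div_neg_eq]
  have : 0 < 1 / a ^ 2 := by positivity
  linarith

theorem exists_sondowI_le : ∃ Z : ℝ, ∀ n : ℕ, n ≠ 0 →
    sondowI n ≤ Z * ((((n : ℝ) + 1) * (n + 2)) ^ 2 / 16 ^ n) := by
  have hZ := (summable_nat_add_iff 1).2 (Real.summable_one_div_nat_pow.2 (show 1 < 2 by norm_num))
  refine ⟨∑' ν : ℕ, 1 / ((ν + 1 : ℕ) : ℝ) ^ 2, fun n hn => ?_⟩
  rw [mul_comm, ← tsum_mul_left, ← (hasSum_integral_sondowIntegrand hn).tsum_eq]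
  refine (hasSum_integral_sondowIntegrand hn).summable.tsum_le_tsum (fun ν => ?_) (hZ.mul_left _)
  refine (neg_betaSqPrimitive_le hn (by linarith [(Nat.cast_nonneg ν : (0 : ℝ) ≤ ν)])).trans ?_
  gcongr
  push_cast
  linarith [(Nat.cast_nonneg n : (0 : ℝ) ≤ n)]

theorem tendsto_lcmUpTo_mul_sondowI :
    Tendsto (fun n : ℕ => (lcmUpTo (2 * n) : ℝ) * sondowI n) atTop (𝓝 0) := by
  obtain ⟨K, C, hd⟩ := exists_lcmUpTo_le
  obtain ⟨Z, hI⟩ := exists_sondowI_le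
  have hr : |Real.exp (-0.07)| < 1 := by
    rw [abs_of_pos (Real.exp_pos _)]; exact (Real.exp_lt_exp.2 (by norm_num)).trans_eq Real.exp_zero
  have hlim := (tendsto_pow_const_mul_const_pow_of_abs_lt_one 4 hr).const_mul
    (Real.exp (5 * C ^ 2 + K) * |Z| * 36)
  rw [mul_zero] at hlim
  refine squeeze_zero' ?_ ?_ hlim
  · filter_upwards [eventually_ne_atTop 0] with n hn
    exact mul_nonneg (Nat.cast_nonneg _) (sondowI_pos hn).le
  · filter_upwards [eventually_ne_atTop 0] with n hn
    have hn1 : (1 : ℝ) ≤ n := by exact_mod_cast Nat.one_le_iff_ne_zero.2 hn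
    have hd' : (lcmUpTo (2 * n) : ℝ) ≤ Real.exp (2.7 * n + (5 * C ^ 2 + K)) := by
      refine (hd (2 * n)).trans (Real.exp_le_exp.2 ?_)
      have hs := Real.sq_sqrt (show (0 : ℝ) ≤ ((2 * n : ℕ) : ℝ) from Nat.cast_nonneg _)
      push_cast at hs ⊢
      -- By this square, C√(2n) ≤ 0.1 n + 5C², raising the exponent from 2.6 n to 2.7 n; as log 16 >
      -- 2.77, a factor exp(-0.07 n) is left to beat `n⁴`.
      nlinarith [sq_nonneg (√(2 * n : ℝ) - 10 * C)]
    have h16 : Real.exp (2.77 * n) ≤ (16 : ℝ) ^ n := by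
      have hlog : (2.77 : ℝ) ≤ Real.log 16 := by
        have h2 := Real.log_two_gt_d9
        rw [show (16 : ℝ) = 2 ^ 4 by norm_num, Real.log_pow]
        push_cast
        linarith
      rw [← Real.le_log_iff_exp_le (by positivity), Real.log_pow, mul_comm]
      gcongr
    have hpoly : ((n : ℝ) + 1) * (n + 2) ≤ 6 * n ^ 2 := by nlinarith
    calc (lcmUpTo (2 * n) : ℝ) * sondowI n
        ≤ Real.exp (2.7 * n + (5 * C ^ 2 + K)) *
          (|Z| * ((6 * (n : ℝ) ^ 2) ^ 2 / Real.exp (2.77 * n))) := by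
          gcongr
          · exact (sondowI_pos hn).le
          · refine (hI n hn).trans ?_
            gcongr
            exact le_abs_self Z
      _ = Real.exp (5 * C ^ 2 + K) * |Z| * 36 * ((n : ℝ) ^ 4 * Real.exp (-0.07) ^ n) := by
          rw [← Real.exp_nat_mul, show (n : ℝ) * (-0.07) = 2.7 * n - 2.77 * n by ring,
            Real.exp_sub, Real.exp_add]
          ring

/-! ### The rationality criteria -/

theorem theorem1 :
    (∀ n : ℕ, 0 < n →
      (∀ t : ℝ, (n : ℝ) + 1 ≤ t →
        Summable (hyp3F2Term (n + 1) (n + 1) (2 * n + 1) (2 * n + 2) (2 * n + 1 + t) 1)) ∧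
      MeasureTheory.IntegrableOn (sondowIntegrand n) (Set.Ioi ((n : ℝ) + 1))) ∧
    List.TFAE [
      ∃ n : ℕ, 0 < n ∧
        Int.fract (Real.log (sondowS n : ℝ)) = (lcmUpTo (2 * n) : ℝ) * sondowI n,
      ∃ N : ℕ, ∀ n : ℕ, N ≤ n →
        Int.fract (Real.log (sondowS n : ℝ)) = (lcmUpTo (2 * n) : ℝ) * sondowI n,
      ∃ q : ℚ, Real.eulerMascheroniConstant = (q : ℝ)] := by
  refine ⟨fun n hn => ⟨fun t ht => summable_hyp3F2Term n ?_,
    integrableOn_sondowIntegrand hn.ne'⟩, ?_⟩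
  · have : (1 : ℝ) ≤ n := by exact_mod_cast hn
    linarith
  tfae_have 1 → 3 := fun ⟨n, hn, h⟩ => eulerMascheroniConstant_rational_of_fract hn.ne' h
  tfae_have 2 → 1 := fun ⟨N, h⟩ =>
    ⟨N + 1, N.succ_pos, h (N + 1) N.le_succ⟩
  tfae_have 3 → 2 := fun ⟨q, hq⟩ => by
    have hlt := tendsto_lcmUpTo_mul_sondowI.eventually_lt_const zero_lt_one
    obtain ⟨N, hN⟩ := eventually_atTop.1
      ((hlt.and (eventually_ne_atTop 0)).and (eventually_ge_atTop q.den))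
    refine ⟨N, fun n hn => ?_⟩
    obtain ⟨⟨h1, h2⟩, h3⟩ := hN n hn
    exact fract_log_sondowS_of_rational hq h2 (by omega) h1
  tfae_finish
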